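/- For integers $r\ge 1$, $s_1\ge 2$ and $s_2,\dots,s_r\ge 1$, let $K_r^+(s_1,\dots,s_r)$ be the graph obtained from the complete $r$-partite graph with parts of sizes $s_1,\dots,s_r$ by adding one edge inside the first part (the part of size $s_1$), and let $t_r(n)$ be the number of edges of the $r$-partite Turán graph of order $n$, that is, of the complete $r$-partite graph on $n$ vertices whose part sizes differ by at most one. Let $r\ge 2$ be an integer, let $n \geq 2$ be an integer, and let $c$ be a real number with $$\frac{2}{\ln n}\le c\le r^{-(r+7)(r+1)}.$$ Then every (finite, simple) graph $G$ of order $n$ with exactly $t_r(n)+1$ edges contains, as a not necessarily induced subgraph, a $$K_r^+\bigl(\lfloor c\ln n\rfloor,\dots,\lfloor c\ln n\rfloor,\lceil n^{1-\sqrt c}\rceil\bigr),$$ where there are $r$ parts, the last one has size $\lceil n^{1-\sqrt c}\rceil$ and each of the other $r-1$ parts, including the first, which carries the added edge, has size $\lfloor c\ln n\rfloor$. -/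

import Mathlib

/-- `K_r⁺(s₀, …, s_{r-1})`: the complete `r`-partite graph whose `i`-th part has `s i` vertices,
with one edge added inside the first part (index `0`), joining its vertices `0` and `1`.
This is meant for `1 ≤ r` and a first part of size at least `2`; otherwise no edge is added. -/
def multipartitePlus {r : ℕ} (s : Fin r → ℕ) : SimpleGraph (Σ i : Fin r, Fin (s i)) :=
  SimpleGraph.completeMultipartiteGraph (fun i : Fin r => Fin (s i)) ⊔
    SimpleGraph.fromRel (fun v w =>
      v.1.val = 0 ∧ v.2.val = 0 ∧ w.1.val = 0 ∧ w.2.val = 1)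

/-- The part sizes `(a, …, a, b)` of `r` parts: the last part has size `b`, all the others `a`. -/
def partSizes (r a b : ℕ) : Fin r → ℕ :=
  fun i => if i.val + 1 = r then b else a

/-! A vertex set `U` maximizing `2 e(U) - lam |U|²`, with `lam` slightly below `1 - 1/r`, has order
at least `n / (3 r²)`. Deleting a vertex cannot improve `U`, so its minimum degree is about `lam
|U|`; and it still beats Turán's bound, so it spans an `(r + 1)`-clique (`exists_induce_degree_ge`).

Counting neighbours in that clique yields an edge `uv` whose common neighbourhood `A` is so large
that any `r - 2` vertices have at least `|U| / r³` common neighbours inside `A`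
(`exists_adj_card_common_ge`). All parts but the first are grown inside `A`. The first part need not
lie in `A`: it consists of `u`, `v` and further vertices joined to the other parts.

The growth keeps an indexed family of tuples whose coordinates will become the parts. Adding a
coordinate shrinks the index set by a factor `M = 2 r⁶` (`exists_subset_card_le_common`), so one
starts with `s M ^ r` indices, a small multiple of `log n`. The last selection starts from only `s
M` indices and costs a factor `2 ^ (s M) M`, where `2 ^ (s M) ≤ n ^ (√c / 2)`; this leaves room for
a part of size `n ^ (1 - √c)`. -/

/-! ### Selecting indices with a large common intersection -/

open Finset in
/-- A Kővári–Sós–Turán type selection: if every set of a family `E` indexed by `I` is dense, then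
some subfamily of prescribed size has a large common intersection. -/
theorem exists_subset_card_le_common {ι W : Type*} [Fintype W] [DecidableEq W] [DecidableEq ι]
    (I : Finset ι) (E : ι → Finset W) {M m : ℕ} (hM : 0 < M) (hm : M * m ≤ #I)
    (hE : ∀ a ∈ I, 2 * Fintype.card W ≤ M * #(E a)) :
    ∃ J ⊆ I, #J = m ∧ Fintype.card W ≤ 2 ^ #I * M * #{x : W | ∀ a ∈ J, x ∈ E a} := by
  have hmI : m ≤ #I := (Nat.le_mul_of_pos_left m hM).trans hm
  let d : W → ℕ := fun x => #{a ∈ I | x ∈ E a}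
  let X : Finset W := {x | m ≤ d x}
  have hcount : ∑ x, d x = ∑ a ∈ I, #(E a) := by
    have := Finset.sum_card_bipartiteAbove_eq_sum_card_bipartiteBelow
      (s := (univ : Finset W)) (t := I) (fun x a => x ∈ E a)
    simpa [Finset.bipartiteAbove, Finset.bipartiteBelow, d] using this
  have hlow : #I * (2 * Fintype.card W) ≤ M * ∑ x, d x := by
    rw [hcount, mul_sum, ← smul_eq_mul, ← sum_const]
    exact sum_le_sum hE
  have hup : ∑ x, d x ≤ #X * #I + Fintype.card W * m := by
    rw [← Finset.sum_filter_add_sum_filter_not univ (fun x => m ≤ d x)]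
    refine add_le_add ?_ ?_
    · exact sum_le_card_nsmul _ _ _ fun x _ => card_le_card (filter_subset _ _)
    · refine (sum_le_card_nsmul _ _ m fun x hx => ?_).trans ?_
      · exact (not_le.1 (mem_filter.1 hx).2).le
      · exact Nat.mul_le_mul_right _ (card_le_univ _)
  -- As `M * m ≤ #I`, the points outside `X` account for at most half of the guaranteed incidences.
  have hX : #I * Fintype.card W ≤ #I * (M * #X) := by nlinarith
  rcases Nat.eq_zero_or_pos (#I) with h0 | hpos
  · refine ⟨∅, empty_subset _, by simp; omega, ?_⟩
    simp [h0]
    exact Nat.le_mul_of_pos_left _ hM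
  have hX' : Fintype.card W ≤ M * #X := Nat.le_of_mul_le_mul_left hX hpos
  rcases X.eq_empty_or_nonempty with hXe | hXne
  · obtain ⟨J, hJ, hJm⟩ := exists_subset_card_eq hmI
    refine ⟨J, hJ, hJm, ?_⟩
    rw [hXe, card_empty, mul_zero] at hX'
    exact hX'.trans (Nat.zero_le _)
  -- Pigeonhole over the at most `2 ^ #I` traces on `I`: points with trace `J` lie in every `E a`,
  -- `a ∈ J`.
  have hfib : ∃ J ∈ I.powerset, (#X : ℚ) / 2 ^ #I ≤ #{x ∈ X | ({a ∈ I | x ∈ E a} : Finset ι) = J} := by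
    refine exists_le_card_fiber_of_nsmul_le_card_of_maps_to (M := ℚ)
      (f := fun x => ({a ∈ I | x ∈ E a} : Finset ι)) (fun x _ => by simp) ⟨∅, by simp⟩ ?_
    rw [card_powerset, nsmul_eq_mul]
    push_cast
    rw [mul_div_cancel₀]
    positivity
  obtain ⟨J, hJI, hJ⟩ := hfib
  have hpos2 : (0 : ℚ) < 2 ^ #I := by positivity
  have hXpos : (0 : ℚ) < #X := by exact_mod_cast hXne.card_pos
  have hne : ({x ∈ X | ({a ∈ I | x ∈ E a} : Finset ι) = J}).Nonempty := by
    rw [← card_pos]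
    have : (0 : ℚ) < #{x ∈ X | ({a ∈ I | x ∈ E a} : Finset ι) = J} :=
      lt_of_lt_of_le (by positivity) hJ
    exact_mod_cast this
  obtain ⟨x, hx⟩ := hne
  have hxJ := (mem_filter.1 hx).2
  have hJm : m ≤ #J := by
    rw [← hxJ]
    exact (mem_filter.1 (mem_filter.1 hx).1).2
  obtain ⟨J', hJ', hJ'm⟩ := exists_subset_card_eq hJm
  refine ⟨J', hJ'.trans (mem_powerset.1 hJI), hJ'm, ?_⟩
  have hle : #X ≤ 2 ^ #I * #{x ∈ X | ({a ∈ I | x ∈ E a} : Finset ι) = J} := by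
    rw [div_le_iff₀' hpos2] at hJ
    exact_mod_cast hJ
  have hsub : #{x ∈ X | ({a ∈ I | x ∈ E a} : Finset ι) = J} ≤ #{x : W | ∀ a ∈ J', x ∈ E a} := by
    refine card_le_card fun z hz => ?_
    have hzJ := (mem_filter.1 hz).2
    simp only [mem_filter, mem_univ, true_and]
    intro a ha
    have := hJ' ha
    rw [← hzJ] at this
    exact (mem_filter.1 this).2
  calc Fintype.card W ≤ M * #X := hX'
    _ ≤ M * (2 ^ #I * #{x : W | ∀ a ∈ J', x ∈ E a}) :=
        Nat.mul_le_mul_left _ (hle.trans (Nat.mul_le_mul_left _ hsub))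
    _ = _ := by ring

/-! ### Codegrees in a clique and degrees in an extremal vertex set -/

open Finset in
/-- Every `(r + 1)`-clique contains an edge whose codegree is larger than the lower bound that the
minimum degree alone gives. -/
theorem exists_adj_card_common_ge {W : Type*} [Fintype W] [DecidableEq W] (H : SimpleGraph W)
    [DecidableRel H.Adj] {r : ℕ} {Q : Finset W} (hQ : H.IsNClique (r + 1) Q) (hr : 1 ≤ r)
    {D : ℝ} (hD : ∀ v, D ≤ H.degree v) :
    ∃ u v, H.Adj u v ∧ 2 * ((r : ℝ) ^ 2 - 1) * D - r * (r - 1) * Fintype.card W ≤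
      (r + 1) * r * #{x | H.Adj u x ∧ H.Adj v x} := by
  let d : W → ℕ := fun x => #{q ∈ Q | H.Adj q x}
  have h1 : ∑ x, (d x : ℝ) = ∑ q ∈ Q, (H.degree q : ℝ) := by
    have := Finset.sum_card_bipartiteAbove_eq_sum_card_bipartiteBelow
      (s := (univ : Finset W)) (t := Q) (fun x q => H.Adj q x)
    simp only [Finset.bipartiteAbove, Finset.bipartiteBelow] at this
    have h' : ∀ q, #{a | H.Adj q a} = H.degree q := fun q => by
      rw [SimpleGraph.degree, SimpleGraph.neighborFinset_eq_filter]
    simp only [h'] at this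
    exact_mod_cast this
  have h2 : ∑ x, ((d x : ℝ) * d x - d x) =
      ∑ p ∈ Q.offDiag, (#{x | H.Adj p.1 x ∧ H.Adj p.2 x} : ℝ) := by
    have := Finset.sum_card_bipartiteAbove_eq_sum_card_bipartiteBelow
      (s := (univ : Finset W)) (t := Q.offDiag) (fun x p => H.Adj p.1 x ∧ H.Adj p.2 x)
    simp only [Finset.bipartiteAbove, Finset.bipartiteBelow] at this
    have h' : ∀ x, ((d x : ℝ) * d x - d x) = (#{p ∈ Q.offDiag | H.Adj p.1 x ∧ H.Adj p.2 x} : ℝ) := by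
      intro x
      have : ({p ∈ Q.offDiag | H.Adj p.1 x ∧ H.Adj p.2 x}) = ({q ∈ Q | H.Adj q x}).offDiag := by
        ext p; simp only [mem_filter, mem_offDiag]; tauto
      rw [this, offDiag_card, Nat.cast_sub (Nat.le_mul_self _), Nat.cast_mul]
    rw [sum_congr rfl fun x _ => h' x]
    exact_mod_cast this
  -- A product `(d - r)(d - r + 1)` of consecutive integers is nonnegative; equality holds at `d = r
  -- - 1` and `d = r`.
  have h3 : ∀ x, 2 * ((r : ℝ) - 1) * d x - r * (r - 1) ≤ (d x : ℝ) * d x - d x := by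
    intro x
    have : (0 : ℝ) ≤ ((d x : ℝ) - r) * (d x - (r - 1)) := by
      rcases le_or_gt r (d x) with h | h
      · have : (r : ℝ) ≤ d x := by exact_mod_cast h
        exact mul_nonneg (by linarith) (by linarith)
      · have : (d x : ℝ) + 1 ≤ r := by exact_mod_cast h
        exact mul_nonneg_of_nonpos_of_nonpos (by linarith) (by linarith)
    nlinarith
  have hr' : (1 : ℝ) ≤ r := by exact_mod_cast hr
  have h4 : ((r : ℝ) + 1) * D ≤ ∑ x, (d x : ℝ) := by
    rw [h1]
    have := card_nsmul_le_sum Q (fun q => (H.degree q : ℝ)) D fun q _ => hD q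
    rw [hQ.card_eq, nsmul_eq_mul] at this
    exact_mod_cast this
  have h5 : 2 * ((r : ℝ) ^ 2 - 1) * D - r * (r - 1) * Fintype.card W ≤
      ∑ p ∈ Q.offDiag, (#{x | H.Adj p.1 x ∧ H.Adj p.2 x} : ℝ) := by
    rw [← h2]
    refine le_trans ?_ (sum_le_sum fun x _ => h3 x)
    rw [sum_sub_distrib, ← mul_sum]
    simp only [sum_const, card_univ, nsmul_eq_mul]
    nlinarith [mul_le_mul_of_nonneg_left h4 (by linarith : (0 : ℝ) ≤ 2 * (r - 1))]
  have hcard : #Q.offDiag = (r + 1) * r := by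
    rw [offDiag_card, hQ.card_eq]
    rw [Nat.mul_add, mul_one, Nat.add_sub_cancel]
  by_contra! hcon
  have h6 : ∑ p ∈ Q.offDiag, (#{x | H.Adj p.1 x ∧ H.Adj p.2 x} : ℝ) * ((r + 1) * r) <
      ∑ p ∈ Q.offDiag, (2 * ((r : ℝ) ^ 2 - 1) * D - r * (r - 1) * Fintype.card W) := by
    refine sum_lt_sum_of_nonempty ?_ fun p hp => ?_
    · rw [← card_pos, hcard]; positivity
    · rw [mem_offDiag] at hp
      rw [mul_comm]
      exact hcon p.1 p.2 (hQ.isClique hp.1 hp.2.1 hp.2.2)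
  rw [← sum_mul, sum_const, hcard, nsmul_eq_mul] at h6
  push_cast at h6
  have : (0 : ℝ) < (r + 1) * r := by positivity
  nlinarith

open Finset in
/-- A vertex set maximizing `2 e(U) - lam |U|²` spans a graph of large minimum degree. -/
theorem le_card_adj_of_maximal {V : Type*} [Fintype V] [DecidableEq V] (G : SimpleGraph V)
    [DecidableRel G.Adj] {lam : ℝ} (hlam : lam ≤ 2) {U : Finset V}
    (hU : ∀ S : Finset V, ∑ x ∈ S, (#{y ∈ S | G.Adj x y} : ℝ) - lam * (#S : ℝ) ^ 2 ≤
      ∑ x ∈ U, (#{y ∈ U | G.Adj x y} : ℝ) - lam * (#U : ℝ) ^ 2) {v : V} (hv : v ∈ U) :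
    lam * #U - 1 ≤ #{y ∈ U | G.Adj v y} := by
  have h := hU (U.erase v)
  have hc : (#(U.erase v) : ℝ) = #U - 1 := by
    rw [card_erase_of_mem hv, Nat.cast_sub (card_pos.2 ⟨v, hv⟩), Nat.cast_one]
  have key : ∑ x ∈ U, (#{y ∈ U | G.Adj x y} : ℝ) =
      ∑ x ∈ U.erase v, (#{y ∈ U.erase v | G.Adj x y} : ℝ) + 2 * #{y ∈ U | G.Adj v y} := by
    have e : ∀ (S : Finset V) x, (#{y ∈ S | G.Adj x y} : ℝ) = ∑ y ∈ S, if G.Adj x y then 1 else 0 :=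
      fun S x => by rw [card_filter]; push_cast; rfl
    simp only [e]
    rw [← add_sum_erase _ _ hv,
      sum_congr rfl fun x _ => (add_sum_erase U (fun y => if G.Adj x y then (1 : ℝ) else 0) hv).symm,
      sum_add_distrib]
    have : ∑ y ∈ U, (if G.Adj v y then (1 : ℝ) else 0) =
        ∑ x ∈ U.erase v, (if G.Adj x v then (1 : ℝ) else 0) := by
      rw [← add_sum_erase _ _ hv]
      simp [G.adj_comm]
    rw [this]
    ring
  rw [key, hc] at h
  -- Maximality now reads `2 deg v ≥ lam (2 #U - 1)`, and `lam ≤ 2` absorbs the remainder.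
  nlinarith

/-! ### Growing families of tuples -/

/-- A family of `j`-tuples indexed by `I`, whose coordinates span a complete `j`-partite graph in
`H` and are pairwise distinct for different indices. -/
structure MatchedFamily {W : Type*} (H : SimpleGraph W) (j : ℕ) (I : Finset ℕ) (y : ℕ → ℕ → W) :
    Prop where
  adj : ∀ a ∈ I, ∀ b ∈ I, ∀ i < j, ∀ i' < j, i ≠ i' → H.Adj (y a i) (y b i')
  inj : ∀ a ∈ I, ∀ b ∈ I, ∀ i < j, y a i = y b i → a = b

open Finset in
theorem MatchedFamily.exists_extend {W : Type*} [Fintype W] [DecidableEq W] {H : SimpleGraph W}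
    {j : ℕ} {I : Finset ℕ} {y : ℕ → ℕ → W} (h : MatchedFamily H j I y) {M m : ℕ} (hM : 0 < M)
    (hm : M * m ≤ #I) (E : ℕ → Finset W) (hE : ∀ a ∈ I, 2 * Fintype.card W ≤ M * #(E a))
    (hadj : ∀ a ∈ I, ∀ x ∈ E a, ∀ i < j, H.Adj x (y a i))
    (hN : m * 2 ^ #I * M ≤ Fintype.card W) [Nonempty W] :
    ∃ J ⊆ I, #J = m ∧ ∃ x : ℕ → W, (∀ a ∈ J, x a ∈ E a) ∧
      MatchedFamily H (j + 1) J (fun a => Function.update (y a) j (x a)) := by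
  obtain ⟨J, hJI, hJm, hJ⟩ := exists_subset_card_le_common I E hM hm hE
  have hle : #J ≤ #{x : W | ∀ a ∈ J, x ∈ E a} := by
    rw [hJm]
    refine Nat.le_of_mul_le_mul_left ((?_ : _ ≤ Fintype.card W).trans hJ)
      (by positivity : 0 < 2 ^ #I * M)
    calc 2 ^ #I * M * m = m * 2 ^ #I * M := by ring
      _ ≤ _ := hN
  -- Any injection into the common set will do: each of its points is adjacent to all tuples indexed
  -- by `J`, so adjacency holds across different indices too.
  obtain ⟨f⟩ : Nonempty (J ↪ ({x : W | ∀ a ∈ J, x ∈ E a} : Finset W)) :=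
    Function.Embedding.nonempty_of_card_le (by rwa [Fintype.card_coe, Fintype.card_coe])
  classical
  let x : ℕ → W := fun a => if ha : a ∈ J then f ⟨a, ha⟩ else Classical.arbitrary W
  have hx : ∀ a (ha : a ∈ J), x a = f ⟨a, ha⟩ := fun a ha => dif_pos ha
  have hxE : ∀ a ∈ J, ∀ b ∈ J, x a ∈ E b := by
    intro a ha b hb
    rw [hx a ha]
    exact (mem_filter.1 (f ⟨a, ha⟩).2).2 b hb
  refine ⟨J, hJI, hJm, x, fun a ha => hxE a ha a ha, ?_, ?_⟩
  · intro a ha b hb i hi i' hi' hne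
    rcases Nat.lt_succ_iff_lt_or_eq.1 hi with hi1 | rfl <;>
      rcases Nat.lt_succ_iff_lt_or_eq.1 hi' with hi2 | rfl
    · rw [Function.update_of_ne hi1.ne, Function.update_of_ne hi2.ne]
      exact h.adj a (hJI ha) b (hJI hb) i hi1 i' hi2 hne
    · rw [Function.update_of_ne hi1.ne, Function.update_self]
      exact (hadj a (hJI ha) _ (hxE b hb a ha) i hi1).symm
    · rw [Function.update_self, Function.update_of_ne hi2.ne]
      exact hadj b (hJI hb) _ (hxE a ha b hb) i' hi2
    · exact absurd rfl hne
  · intro a ha b hb i hi hab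
    rcases Nat.lt_succ_iff_lt_or_eq.1 hi with hi1 | rfl
    · rw [Function.update_of_ne hi1.ne, Function.update_of_ne hi1.ne] at hab
      exact h.inj a (hJI ha) b (hJI hb) i hi1 hab
    · rw [Function.update_self, Function.update_self, hx a ha, hx b hb] at hab
      exact congrArg Subtype.val (f.injective (Subtype.ext hab))

open Finset in
-- Each new coordinate costs a factor `M` in the number of indices. Taking `K` larger than `k`
-- leaves spare factors for the selections that follow.
theorem exists_matchedFamily {W : Type*} [Fintype W] [DecidableEq W] [Nonempty W]
    (H : SimpleGraph W) [DecidableRel H.Adj] (A : Finset W) {M s K k : ℕ} (hM : 0 < M)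
    (hkK : k ≤ K)
    (hA : ∀ j < k, ∀ y : ℕ → W, 2 * Fintype.card W ≤ M * #{x ∈ A | ∀ i < j, H.Adj x (y i)})
    (hN : s * M ^ K * 2 ^ (s * M ^ K) * M ≤ Fintype.card W) :
    ∀ j ≤ k, ∃ I : Finset ℕ, ∃ y : ℕ → ℕ → W, #I = s * M ^ (K - j) ∧ MatchedFamily H j I y ∧
      ∀ a ∈ I, ∀ i < j, y a i ∈ A := by
  intro j
  induction j with
  | zero =>
    intro _
    refine ⟨range (s * M ^ K), fun _ _ => Classical.arbitrary W, by simp, ⟨?_, ?_⟩, ?_⟩ <;> simp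
  | succ j ih =>
    intro hj
    obtain ⟨I, y, hI, hy, hyA⟩ := ih (by omega)
    have hp1 : s * M ^ (K - (j + 1)) ≤ s * M ^ K :=
      Nat.mul_le_mul_left _ (Nat.pow_le_pow_right hM (by omega))
    have hp2 : s * M ^ (K - j) ≤ s * M ^ K :=
      Nat.mul_le_mul_left _ (Nat.pow_le_pow_right hM (by omega))
    obtain ⟨J, hJI, hJ, x, hxE, hx⟩ := hy.exists_extend (m := s * M ^ (K - (j + 1))) hM
      (by rw [hI, show K - j = K - (j + 1) + 1 by omega, pow_succ]; exact le_of_eq (by ring))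
      (fun a => {x ∈ A | ∀ i < j, H.Adj x (y a i)}) (fun a _ => hA j hj (y a))
      (fun a _ x hx => (mem_filter.1 hx).2)
      (by
        refine le_trans ?_ hN
        rw [hI]
        gcongr
        exact one_le_two)
    refine ⟨J, _, hJ, hx, fun a ha i hi => ?_⟩
    rcases Nat.lt_succ_iff_lt_or_eq.1 hi with hi1 | rfl
    · rw [Function.update_of_ne hi1.ne]
      exact hyA a (hJI ha) i hi1
    · rw [Function.update_self]
      exact (mem_filter.1 (hxE a ha)).1

/-! ### Assembling the copy -/

theorem exists_equiv_apply_eq {α : Type*} {m : ℕ} (e : Fin m ≃ α) (hm : 2 ≤ m) {u v : α}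
    (huv : u ≠ v) : ∃ f : Fin m ≃ α, ∀ a, (a.val = 0 → f a = u) ∧ (a.val = 1 → f a = v) := by
  classical
  let g := e.trans (Equiv.swap (e ⟨0, by omega⟩) u)
  have g0 : g ⟨0, by omega⟩ = u := by simp [g]
  refine ⟨g.trans (Equiv.swap (g ⟨1, by omega⟩) v), fun a => ⟨fun ha => ?_, fun ha => ?_⟩⟩
  · have : a = ⟨0, by omega⟩ := Fin.ext ha
    rw [this, Equiv.trans_apply, g0, Equiv.swap_apply_of_ne_of_ne _ huv]
    rw [← g0]
    intro hh
    simpa using g.injective hh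
  · have : a = ⟨1, by omega⟩ := Fin.ext ha
    rw [this]
    simp

open Finset in
-- Disjointness of the parts need not be assumed: vertices of different parts are adjacent, hence
-- distinct.
theorem multipartitePlus_isContained {W : Type*} {H : SimpleGraph W} {r : ℕ} {σ : Fin r → ℕ}
    (P : Fin r → Finset W) (hcard : ∀ i, #(P i) = σ i)
    (hadj : ∀ i j, i < j → ∀ x ∈ P i, ∀ y ∈ P j, H.Adj x y) {u v : W} (huv : H.Adj u v)
    (hu : ∀ i : Fin r, i.val = 0 → u ∈ P i) (hv : ∀ i : Fin r, i.val = 0 → v ∈ P i) :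
    (multipartitePlus σ).IsContained H := by
  have hadj' : ∀ i j, i ≠ j → ∀ x ∈ P i, ∀ y ∈ P j, H.Adj x y := by
    intro i j hij x hx y hy
    rcases lt_or_gt_of_ne hij with h | h
    · exact hadj i j h x hx y hy
    · exact (hadj j i h y hy x hx).symm
  have hf : ∀ i, ∃ f : Fin (σ i) ≃ P i, i.val = 0 →
      ∀ a, (a.val = 0 → (f a : W) = u) ∧ (a.val = 1 → (f a : W) = v) := by
    intro i
    have e : Fin (σ i) ≃ P i := (Finset.equivFinOfCardEq (hcard i)).symm
    by_cases hi : i.val = 0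
    · have h2 : 2 ≤ σ i := by
        rw [← hcard i]
        exact one_lt_card.2 ⟨u, hu i hi, v, hv i hi, huv.ne⟩
      obtain ⟨f, hf⟩ := exists_equiv_apply_eq e h2 (u := ⟨u, hu i hi⟩) (v := ⟨v, hv i hi⟩)
        (fun h => huv.ne (congrArg Subtype.val h))
      exact ⟨f, fun _ a => ⟨fun ha => congrArg Subtype.val ((hf a).1 ha),
        fun ha => congrArg Subtype.val ((hf a).2 ha)⟩⟩
    · exact ⟨e, fun h => absurd h hi⟩
  choose f hf using hf
  refine ⟨⟨⟨fun p => f p.1 p.2, ?_⟩, ?_⟩⟩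
  · have hrel : ∀ p q : Σ i : Fin r, Fin (σ i),
        (p.1.val = 0 ∧ p.2.val = 0 ∧ q.1.val = 0 ∧ q.2.val = 1) →
        H.Adj (f p.1 p.2) (f q.1 q.2) := by
      rintro p q ⟨h1, h2, h3, h4⟩
      rw [((hf p.1 h1) p.2).1 h2, ((hf q.1 h3) q.2).2 h4]
      exact huv
    intro p q hpq
    rw [multipartitePlus, SimpleGraph.sup_adj, SimpleGraph.fromRel_adj] at hpq
    rcases hpq with h | ⟨_, h | h⟩
    · exact hadj' p.1 q.1 (by simpa using h) _ (f p.1 p.2).2 _ (f q.1 q.2).2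
    · exact hrel p q h
    · exact (hrel q p h).symm
  · rintro ⟨i, a⟩ ⟨j, b⟩ hab
    change (f i a : W) = f j b at hab
    by_cases hij : i = j
    · subst hij
      rw [(f i).injective (Subtype.ext hab)]
    · have := hadj' i j hij _ (f i a).2 _ (f j b).2
      rw [hab] at this
      exact absurd rfl this.ne

open Finset in
-- Three rounds of selection: tuples `y` in `A` leave `s M²` indices; vertices `x`, adjacent to the
-- tuples but not necessarily in `A`, leave `s M`; the last part, chosen in `A`, leaves `s`. Then
-- `u`, `v` and some of the `x` form the first part.
theorem multipartitePlus_isContained_of_dense {W : Type*} [Fintype W] [DecidableEq W]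
    {H : SimpleGraph W} [DecidableRel H.Adj] {k s t M : ℕ} (hM : 0 < M) (hs : 2 ≤ s)
    {u v : W} (huv : H.Adj u v) {A : Finset W} (hA : ∀ x ∈ A, H.Adj u x ∧ H.Adj v x)
    (h1 : ∀ j < k, ∀ y : ℕ → W, 2 * Fintype.card W ≤ M * #{x ∈ A | ∀ i < j, H.Adj x (y i)})
    (h2 : ∀ y : ℕ → W, 2 * Fintype.card W ≤ M * #{z | (∀ i < k, H.Adj z (y i)) ∧
      2 * Fintype.card W ≤ M * #{x ∈ A | (∀ i < k, H.Adj x (y i)) ∧ H.Adj x z}})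
    (hN : s * M ^ (k + 2) * 2 ^ (s * M ^ (k + 2)) * M ≤ Fintype.card W)
    (ht : t * 2 ^ (s * M) * M ≤ Fintype.card W) :
    (multipartitePlus (partSizes (k + 2) s t)).IsContained H := by
  have : Nonempty W := ⟨u⟩
  obtain ⟨I, y, hI, hy, hyA⟩ := exists_matchedFamily H A hM (K := k + 2) (by omega) h1 hN k le_rfl
  rw [show k + 2 - k = 2 by omega] at hI
  have hp : ∀ e ≤ k + 2, s * M ^ e ≤ s * M ^ (k + 2) := fun e he =>
    Nat.mul_le_mul_left _ (Nat.pow_le_pow_right hM he)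
  obtain ⟨J, hJI, hJ, x, hxE, hx⟩ := hy.exists_extend (m := s * M) hM
    (by rw [hI]; exact le_of_eq (by ring))
    (fun a => {z | (∀ i < k, H.Adj z (y a i)) ∧
      2 * Fintype.card W ≤ M * #{x ∈ A | (∀ i < k, H.Adj x (y a i)) ∧ H.Adj x z}})
    (fun a _ => h2 (y a)) (fun a _ x hx => (mem_filter.1 hx).2.1)
    (by
      refine le_trans ?_ hN
      rw [hI]
      have := hp 1 (by omega)
      rw [pow_one] at this
      have := hp 2 (by omega)
      gcongr
      exact one_le_two)
  obtain ⟨L, hLJ, hL, hX⟩ := exists_subset_card_le_common J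
    (fun a => {z ∈ A | (∀ i < k, H.Adj z (y a i)) ∧ H.Adj z (x a)}) hM (m := s)
    (by rw [hJ, mul_comm]) (fun a ha => (mem_filter.1 (hxE a ha)).2.2)
  have htX : t ≤ #{z : W | ∀ a ∈ L, z ∈
      ({z ∈ A | (∀ i < k, H.Adj z (y a i)) ∧ H.Adj z (x a)} : Finset W)} := by
    refine Nat.le_of_mul_le_mul_left ((?_ : _ ≤ Fintype.card W).trans hX)
      (by positivity : 0 < 2 ^ #J * M)
    calc 2 ^ #J * M * t = t * 2 ^ (s * M) * M := by rw [hJ]; ring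
      _ ≤ _ := ht
  obtain ⟨T, hTX, hT⟩ := exists_subset_card_eq htX
  have hTA : ∀ z ∈ T, ∀ a ∈ L, z ∈ A ∧ (∀ i < k, H.Adj z (y a i)) ∧ H.Adj z (x a) :=
    fun z hz a ha => mem_filter.1 ((mem_filter.1 (hTX hz)).2 a ha)
  have hLne : L.Nonempty := card_pos.1 (by omega)
  have hyx : ∀ a ∈ L, ∀ b ∈ L, ∀ i < k, H.Adj (x a) (y b i) := by
    intro a ha b hb i hi
    have := hx.adj a (hLJ ha) b (hLJ hb) k (by omega) i (by omega) hi.ne'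
    simpa [Function.update_of_ne hi.ne] using this
  have hxinj : Set.InjOn x L := by
    intro a ha b hb hab
    exact hx.inj a (hLJ ha) b (hLJ hb) k (by omega) (by simpa using hab)
  have hyinj : ∀ i < k, Set.InjOn (fun a => y a i) L := by
    intro i hi a ha b hb hab
    exact hy.inj a (hJI (hLJ ha)) b (hJI (hLJ hb)) i hi hab
  -- The `x a` may coincide with `u` or `v`, so a set of size exactly `s` is chosen between `{u, v}`
  -- and the union.
  obtain ⟨S, huvS, hSsub, hS⟩ := exists_subsuperset_card_eq
    (s := ({u, v} : Finset W)) (t := {u, v} ∪ L.image x) (n := s) subset_union_left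
    (card_le_two.trans hs) (by
      rw [← hL, ← card_image_of_injOn hxinj]
      exact card_le_card subset_union_right)
  have hSmem : ∀ z ∈ S, z = u ∨ z = v ∨ ∃ a ∈ L, x a = z := by
    intro z hz
    have := hSsub hz
    simp only [mem_union, mem_insert, mem_singleton, mem_image] at this
    tauto
  have hST : ∀ z ∈ S, ∀ w ∈ T, H.Adj z w := by
    intro z hz w hw
    obtain ⟨b, hb⟩ := hLne
    rcases hSmem z hz with rfl | rfl | ⟨a, ha, rfl⟩
    · exact (hA w (hTA w hw b hb).1).1
    · exact (hA w (hTA w hw b hb).1).2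
    · exact (hTA w hw a ha).2.2.symm
  have hSy : ∀ z ∈ S, ∀ b ∈ L, ∀ i < k, H.Adj z (y b i) := by
    intro z hz b hb i hi
    have hm := hA _ (hyA b (hJI (hLJ hb)) i hi)
    rcases hSmem z hz with rfl | rfl | ⟨a, ha, rfl⟩
    · exact hm.1
    · exact hm.2
    · exact hyx a ha b hb i hi
  -- Index `0` carries the edge and index `k + 1` is the large part, so coordinate `i` of the tuples
  -- becomes part `i + 1`.
  refine multipartitePlus_isContained
    (fun i => if i.val = 0 then S else if i.val = k + 1 then T else
      L.image (fun a => y a (i.val - 1))) ?_ ?_ huv ?_ ?_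
  · intro i
    have hi := i.isLt
    dsimp only [partSizes]
    by_cases h0 : i.val = 0
    · rw [if_pos h0, if_neg (by omega), hS]
    · rw [if_neg h0]
      by_cases hk : i.val = k + 1
      · rw [if_pos hk, if_pos (by omega), hT]
      · rw [if_neg hk, if_neg (by omega), card_image_of_injOn (hyinj _ (by omega)), hL]
  · intro i j hij z hz w hw
    have hi := i.isLt
    have hj := j.isLt
    have hij' : i.val < j.val := hij
    rw [if_neg (by omega : ¬ j.val = 0)] at hw
    by_cases h0 : i.val = 0
    · rw [if_pos h0] at hz
      by_cases hk : j.val = k + 1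
      · rw [if_pos hk] at hw
        exact hST z hz w hw
      · rw [if_neg hk, mem_image] at hw
        obtain ⟨b, hb, rfl⟩ := hw
        exact hSy z hz b hb _ (by omega)
    · rw [if_neg h0, if_neg (by omega : ¬ i.val = k + 1), mem_image] at hz
      obtain ⟨a, ha, rfl⟩ := hz
      by_cases hk : j.val = k + 1
      · rw [if_pos hk] at hw
        exact ((hTA w hw a ha).2.1 _ (by omega)).symm
      · rw [if_neg hk, mem_image] at hw
        obtain ⟨b, hb, rfl⟩ := hw
        exact hy.adj a (hJI (hLJ ha)) b (hJI (hLJ hb)) _ (by omega) _ (by omega) (by omega)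
  · intro i hi
    rw [if_pos hi]
    exact huvS (by simp)
  · intro i hi
    rw [if_pos hi]
    exact huvS (by simp)

/-! ### Density from the minimum degree -/

open Finset in
-- Each of the `j` conditions discards at most `q` vertices.
theorem le_card_filter_forall_adj {W : Type*} [Fintype W] [DecidableEq W] (H : SimpleGraph W)
    [DecidableRel H.Adj] {q : ℝ} (hq : ∀ v, (Fintype.card W : ℝ) - H.degree v ≤ q) (B : Finset W)
    (y : ℕ → W) (j : ℕ) : (#B : ℝ) - j * q ≤ #{x ∈ B | ∀ i < j, H.Adj x (y i)} := by
  induction j with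
  | zero => simp
  | succ j ih =>
    have hsplit : ({x ∈ B | ∀ i < j, H.Adj x (y i)} : Finset W).card =
        #{x ∈ B | ∀ i < j + 1, H.Adj x (y i)} +
        #{x ∈ ({x ∈ B | ∀ i < j, H.Adj x (y i)} : Finset W) | ¬ H.Adj x (y j)} := by
      rw [← card_filter_add_card_filter_not (s := {x ∈ B | ∀ i < j, H.Adj x (y i)})
        (fun x => H.Adj x (y j)), filter_filter]
      congr 3
      ext x
      rw [Nat.forall_lt_succ_right]
    have hnot : (#{x ∈ ({x ∈ B | ∀ i < j, H.Adj x (y i)} : Finset W) | ¬ H.Adj x (y j)} : ℝ)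
        ≤ q := by
      refine le_trans ?_ (hq (y j))
      have h1 : #{x | H.Adj x (y j)} + #{x | ¬ H.Adj x (y j)} = Fintype.card W := by
        rw [card_filter_add_card_filter_not, card_univ]
      have h2 : H.degree (y j) = #{x | H.Adj x (y j)} := by
        rw [SimpleGraph.degree, SimpleGraph.neighborFinset_eq_filter]
        simp only [H.adj_comm]
      have h3 : #{x ∈ ({x ∈ B | ∀ i < j, H.Adj x (y i)} : Finset W) | ¬ H.Adj x (y j)} ≤
          #{x | ¬ H.Adj x (y j)} := card_le_card (filter_subset_filter _ (subset_univ _))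
      rw [le_sub_iff_add_le, h2]
      exact_mod_cast (by omega)
    have hsplit' : ((#{x ∈ B | ∀ i < j, H.Adj x (y i)} : ℕ) : ℝ) = _ := congrArg Nat.cast hsplit
    push_cast at hsplit' ⊢
    linarith

open Finset in
/-- If `B` is joined densely to `C`, then many vertices of `C` have many neighbours in `B`. -/
theorem le_card_filter_degree_ge {W : Type*} [Fintype W] [DecidableEq W] (H : SimpleGraph W)
    [DecidableRel H.Adj] {B C : Finset W} (hB : B.Nonempty) {w : ℝ} (hw : 0 ≤ w)
    (h : ∀ x ∈ B, 2 * w * Fintype.card W ≤ #{z ∈ C | H.Adj z x}) :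
    w * Fintype.card W ≤ #{z ∈ C | w * #B ≤ #{x ∈ B | H.Adj x z}} := by
  have hcount : ∑ x ∈ B, (#{z ∈ C | H.Adj z x} : ℝ) = ∑ z ∈ C, (#{x ∈ B | H.Adj x z} : ℝ) := by
    have := sum_card_bipartiteAbove_eq_sum_card_bipartiteBelow (s := B) (t := C)
      (fun x z => H.Adj x z)
    simp only [bipartiteAbove, bipartiteBelow] at this
    rw [show (fun x => (#{z ∈ C | H.Adj z x} : ℝ)) = fun x => (#{z ∈ C | H.Adj x z} : ℝ) by
      simp only [H.adj_comm]]
    exact_mod_cast this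
  have hlow : #B * (2 * w * Fintype.card W) ≤ ∑ z ∈ C, (#{x ∈ B | H.Adj x z} : ℝ) := by
    rw [← hcount, ← nsmul_eq_mul]
    exact card_nsmul_le_sum _ _ _ h
  have hup : ∑ z ∈ C, (#{x ∈ B | H.Adj x z} : ℝ) ≤
      #{z ∈ C | w * #B ≤ #{x ∈ B | H.Adj x z}} * (#B : ℝ) + Fintype.card W * (w * #B) := by
    rw [← sum_filter_add_sum_filter_not C (fun z => w * #B ≤ #{x ∈ B | H.Adj x z})]
    refine add_le_add ?_ ?_
    · rw [← nsmul_eq_mul]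
      refine sum_le_card_nsmul _ _ _ fun z _ => ?_
      exact_mod_cast card_le_card (filter_subset _ _)
    · refine (sum_le_card_nsmul _ _ (w * #B) fun z hz => ?_).trans ?_
      · exact (not_le.1 (mem_filter.1 hz).2).le
      · rw [nsmul_eq_mul]
        refine mul_le_mul_of_nonneg_right ?_ (by positivity)
        exact_mod_cast card_le_univ _
  have hBpos : (0 : ℝ) < #B := by exact_mod_cast hB.card_pos
  refine le_of_mul_le_mul_right ?_ hBpos
  nlinarith

open Finset in
-- The weakest density needed is `1 / (4 r⁴)`, for neighbours of `z` in `B`; since `r ≥ 2`, the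
-- single choice `M = 2 r⁶` covers all the selections.
theorem multipartitePlus_isContained_of_degree {W : Type*} [Fintype W] [DecidableEq W]
    {H : SimpleGraph W} [DecidableRel H.Adj] {r s t : ℕ} (hr : 2 ≤ r) (hs : 2 ≤ s)
    (hclique : ¬ H.CliqueFree (r + 1))
    (hdeg : ∀ v, (1 - 1 / (r : ℝ) - 1 / (3 * (r : ℝ) ^ 4)) * Fintype.card W ≤ H.degree v)
    (hN : s * (2 * r ^ 6) ^ r * 2 ^ (s * (2 * r ^ 6) ^ r) * (2 * r ^ 6) ≤ Fintype.card W)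
    (ht : t * 2 ^ (s * (2 * r ^ 6)) * (2 * r ^ 6) ≤ Fintype.card W) :
    (multipartitePlus (partSizes r s t)).IsContained H := by
  obtain ⟨Q, hQ⟩ : ∃ Q, H.IsNClique (r + 1) Q := by
    simpa [SimpleGraph.CliqueFree] using hclique
  obtain ⟨u, v, huv, hcodeg⟩ := exists_adj_card_common_ge H hQ (by omega) hdeg
  have : Nonempty W := ⟨u⟩
  have hR : (2 : ℝ) ≤ r := by exact_mod_cast hr
  have hNpos : (0 : ℝ) < Fintype.card W := by exact_mod_cast Fintype.card_pos
  set N : ℝ := (Fintype.card W : ℝ) with hNdef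
  set R : ℝ := (r : ℝ) with hRdef
  have hR0 : 0 < R := by linarith
  set A : Finset W := {x | H.Adj u x ∧ H.Adj v x} with hAdef
  set q : ℝ := (1 / R + 1 / (3 * R ^ 4)) * N with hqdef
  have hq : ∀ z, N - H.degree z ≤ q := fun z => by
    have := hdeg z
    rw [hqdef]
    linarith
  have hq0 : 0 ≤ q := by positivity
  obtain ⟨k, rfl⟩ : ∃ k, r = k + 2 := ⟨r - 2, by omega⟩
  have hk : (k : ℝ) = R - 2 := by rw [hRdef]; push_cast; ring
  -- With degrees `(1 - 1/r) N` the codegree would exceed `(r - 2) N / r` by `2 N / (r² (r + 1))`;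
  -- the error `1 / (3 r⁴)` still leaves `N / r³`.
  have hAk : N / R ^ 3 ≤ #A - k * q := by
    have h1 : (2 * (R ^ 2 - 1) * ((1 - 1 / R - 1 / (3 * R ^ 4)) * N) - R * (R - 1) * N) /
        ((R + 1) * R) ≤ #A := by
      rw [div_le_iff₀' (by positivity)]
      exact hcodeg
    have h2 : N / R ^ 3 + k * q ≤
        (2 * (R ^ 2 - 1) * ((1 - 1 / R - 1 / (3 * R ^ 4)) * N) - R * (R - 1) * N) /
        ((R + 1) * R) := by
      rw [hk, hqdef, ← sub_nonneg]
      have e : (2 * (R ^ 2 - 1) * ((1 - 1 / R - 1 / (3 * R ^ 4)) * N) - R * (R - 1) * N) /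
        ((R + 1) * R) - (N / R ^ 3 + (R - 2) * ((1 / R + 1 / (3 * R ^ 4)) * N)) =
        N * (2 * R ^ 2 * (R - 2) + 2 * R + 2) / (3 * R ^ 5 * (R + 1)) := by
        field_simp
        ring
      rw [e]
      have : 0 ≤ R - 2 := by linarith
      positivity
    linarith
  have hB : ∀ (y : ℕ → W), ∀ j ≤ k, N / R ^ 3 ≤ #{x ∈ A | ∀ i < j, H.Adj x (y i)} := by
    intro y j hj
    refine hAk.trans (le_trans ?_ (le_card_filter_forall_adj H hq A y j))
    have : (j : ℝ) ≤ k := by exact_mod_cast hj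
    nlinarith
  have hM : (((2 * (k + 2) ^ 6 : ℕ)) : ℝ) = 2 * R ^ 6 := by rw [hRdef]; push_cast; ring
  have hcubic : 2 * N ≤ 2 * R ^ 6 * (N / (4 * R) * (1 / R ^ 3)) := by
    rw [show 2 * R ^ 6 * (N / (4 * R) * (1 / R ^ 3)) = R ^ 2 / 2 * N by field_simp; ring]
    refine mul_le_mul_of_nonneg_right ?_ hNpos.le
    nlinarith
  have hR3 : (1 : ℝ) ≤ R ^ 3 := one_le_pow₀ (by linarith)
  refine multipartitePlus_isContained_of_dense (A := A) (M := 2 * (k + 2) ^ 6) (by positivity) hs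
    huv (fun x hx => (mem_filter.1 hx).2) ?_ ?_ hN ht
  · intro j hj y
    have h1 := hB y j hj.le
    have h2 : 2 * N ≤ 2 * R ^ 6 * #{x ∈ A | ∀ i < j, H.Adj x (y i)} := by
      refine hcubic.trans (mul_le_mul_of_nonneg_left (le_trans ?_ h1) (by positivity))
      rw [show N / R ^ 3 = N * (1 / R ^ 3) by ring]
      refine mul_le_mul_of_nonneg_right (div_le_self hNpos.le (by linarith)) (by positivity)
    rw [← hM, hNdef] at h2
    exact_mod_cast h2
  · intro y
    set B : Finset W := {x ∈ A | ∀ i < k, H.Adj x (y i)} with hBdef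
    have hBk : N / R ^ 3 ≤ #B := hB y k le_rfl
    have hBne : B.Nonempty := by
      rw [← card_pos]
      have : (0 : ℝ) < #B := lt_of_lt_of_le (by positivity) hBk
      exact_mod_cast this
    set C : Finset W := {z | ∀ i < k, H.Adj z (y i)} with hCdef
    have hC : ∀ x ∈ B, 2 * (1 / (4 * R)) * N ≤ #{z ∈ C | H.Adj z x} := by
      intro x _
      -- Treating `x` as one more vertex after the `y i` gives `N - (k + 1) q`, roughly `N / r`.
      have h := le_card_filter_forall_adj H hq univ (Function.update y k x) (k + 1)
      have e : ({z | ∀ i < k + 1, H.Adj z (Function.update y k x i)} : Finset W) =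
          ({z ∈ C | H.Adj z x} : Finset W) := by
        ext z
        simp only [hCdef, mem_filter, mem_univ, true_and]
        rw [Nat.forall_lt_succ_right, Function.update_self]
        refine and_congr_left fun _ => forall₂_congr fun i hi => ?_
        rw [Function.update_of_ne hi.ne]
      rw [e, card_univ] at h
      refine le_trans ?_ h
      push_cast
      rw [hk, hqdef, ← hNdef, ← sub_nonneg]
      have e : N - (R - 2 + 1) * ((1 / R + 1 / (3 * R ^ 4)) * N) - 2 * (1 / (4 * R)) * N =
          N * (3 * R ^ 3 - 2 * R + 2) / (6 * R ^ 4) := by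
        field_simp
        ring
      rw [e]
      have : 0 ≤ 3 * R ^ 3 - 2 * R + 2 := by nlinarith [pow_pos hR0 2]
      positivity
    have hZ := le_card_filter_degree_ge H hBne (by positivity : 0 ≤ 1 / (4 * R)) hC
    have hsub : ({z ∈ C | 1 / (4 * R) * #B ≤ #{x ∈ B | H.Adj x z}} : Finset W) ⊆
        ({z | (∀ i < k, H.Adj z (y i)) ∧ 2 * Fintype.card W ≤ (2 * (k + 2) ^ 6) *
          #{x ∈ A | (∀ i < k, H.Adj x (y i)) ∧ H.Adj x z}} : Finset W) := by
      intro z hz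
      simp only [hCdef, mem_filter, mem_univ, true_and] at hz ⊢
      refine ⟨hz.1, ?_⟩
      have h2 : 2 * N ≤ 2 * R ^ 6 * #{x ∈ B | H.Adj x z} := by
        refine hcubic.trans (mul_le_mul_of_nonneg_left (le_trans ?_ hz.2) (by positivity))
        rw [show N / (4 * R) * (1 / R ^ 3) = 1 / (4 * R) * (N / R ^ 3) by ring]
        exact mul_le_mul_of_nonneg_left hBk (by positivity)
      rw [← hM, hNdef, hBdef, filter_filter] at h2
      exact_mod_cast h2
    have h2 : 2 * N ≤ 2 * R ^ 6 * #{z | (∀ i < k, H.Adj z (y i)) ∧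
        2 * Fintype.card W ≤ (2 * (k + 2) ^ 6) *
          #{x ∈ A | (∀ i < k, H.Adj x (y i)) ∧ H.Adj x z}} := by
      refine hcubic.trans (mul_le_mul_of_nonneg_left ?_ (by positivity))
      refine le_trans ?_ (hZ.trans (by exact_mod_cast card_le_card hsub))
      rw [show 1 / (4 * R) * N = N / (4 * R) * 1 by ring]
      refine mul_le_mul_of_nonneg_left ?_ (by positivity)
      rw [div_le_one (by positivity)]
      exact hR3
    rw [← hM, hNdef] at h2
    exact_mod_cast h2

/-! ### Numerical estimates -/

/-- Bounds on the part sizes `⌊c log n⌋` and `⌈n ^ (1 - √c)⌉` in a host of order at least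
`n / (3 r²)`. -/
theorem part_size_bounds {r n N : ℕ} (hr : 2 ≤ r) {c : ℝ} (hL : 0 < Real.log n)
    (hcL : 2 / Real.log n ≤ c) (hcr : c ≤ ((r : ℝ) ^ ((r + 7) * (r + 1)))⁻¹)
    (hN : (n : ℝ) / (3 * (r : ℝ) ^ 2) ≤ N) :
    2 ≤ ⌊c * Real.log n⌋₊ ∧
    ⌊c * Real.log n⌋₊ * (2 * r ^ 6) ^ r * 2 ^ (⌊c * Real.log n⌋₊ * (2 * r ^ 6) ^ r) * (2 * r ^ 6)
      ≤ N ∧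
    ⌈(n : ℝ) ^ (1 - √c)⌉₊ * 2 ^ (⌊c * Real.log n⌋₊ * (2 * r ^ 6)) * (2 * r ^ 6) ≤ N := by
  have hn0 : (n : ℝ) ≠ 0 := by
    intro h
    simp [h] at hL
  have hnpos : (0 : ℝ) < n := lt_of_le_of_ne (Nat.cast_nonneg n) hn0.symm
  set L := Real.log n with hLdef
  have hexp : (n : ℝ) = Real.exp L := (Real.exp_log hnpos).symm
  have hR : (2 : ℝ) ≤ r := by exact_mod_cast hr
  have hcL' : 2 ≤ c * L := by rwa [div_le_iff₀ hL] at hcL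
  set s := ⌊c * L⌋₊ with hsdef
  have hsle : (s : ℝ) ≤ c * L := Nat.floor_le (by linarith)
  have hc0 : 0 < c := lt_of_lt_of_le (by positivity) hcL
  have hR0 : (0 : ℝ) < r := by linarith
  have hR1 : (1 : ℝ) ≤ r := by linarith
  have hpow : ∀ e ≤ (r + 7) * (r + 1), c * (r : ℝ) ^ e ≤ 1 := by
    intro e he
    have h1 : c * (r : ℝ) ^ ((r + 7) * (r + 1)) ≤ 1 := by
      rwa [← one_div, le_div_iff₀ (by positivity)] at hcr
    exact (mul_le_mul_of_nonneg_left (pow_le_pow_right₀ hR1 he) hc0.le).trans h1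
  -- `27` is `(r + 7) * (r + 1)` at `r = 2`. In the next line `7 * r` pays for `(2 r⁶) ^ r ≤ r ^ (7
  -- r)`, and the extra `r²` for a factor `4`.
  have h27 : c * (r : ℝ) ^ 27 ≤ 1 := hpow 27 (by nlinarith)
  have h7 : c * (r : ℝ) ^ (7 * r + 2) ≤ 1 := hpow _ (by nlinarith)
  have hpow2 : ∀ a b : ℕ, (2 : ℝ) ^ a * (r : ℝ) ^ b ≤ (r : ℝ) ^ (a + b) := by
    intro a b
    rw [pow_add]
    gcongr
  have hLR : 2 * (r : ℝ) ^ 27 ≤ L := by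
    have := mul_le_mul_of_nonneg_right h27 hL.le
    nlinarith [pow_pos hR0 27]
  have hM : (2 : ℝ) * (r : ℝ) ^ 6 ≤ (r : ℝ) ^ 7 := by simpa using hpow2 1 6
  refine ⟨Nat.le_floor (by exact_mod_cast hcL'), ?_, ?_⟩
  · set P := s * (2 * r ^ 6) ^ r with hPdef
    have hP : 4 * (P : ℝ) ≤ L := by
      have h1 : (P : ℝ) ≤ c * L * (r : ℝ) ^ (7 * r) := by
        rw [hPdef]
        push_cast
        rw [pow_mul]
        gcongr
      have h2 : c * L * (r : ℝ) ^ (7 * r) * 4 ≤ L := by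
        have h3 : c * (r : ℝ) ^ (7 * r) * 4 ≤ 1 := by
          refine le_trans ?_ h7
          rw [pow_add, ← mul_assoc]
          refine mul_le_mul_of_nonneg_left ?_ (by positivity)
          nlinarith
        nlinarith
      linarith
    -- Here `√n` bounds the exponential factor; the other `√n` absorbs the polynomial in `r`.
    have h4P : (P : ℝ) * 2 ^ P ≤ Real.exp (L / 2) := by
      have h1 : (P : ℝ) ≤ 2 ^ P := by exact_mod_cast P.lt_two_pow_self.le
      have h2 : (2 : ℝ) ^ P ≤ Real.exp P := by
        rw [← Real.exp_one_pow]
        gcongr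
        linarith [Real.add_one_le_exp (1 : ℝ)]
      calc (P : ℝ) * 2 ^ P ≤ Real.exp P * Real.exp P :=
            mul_le_mul (h1.trans h2) h2 (by positivity) (by positivity)
        _ = Real.exp (2 * P) := by rw [← Real.exp_add]; ring_nf
        _ ≤ _ := Real.exp_le_exp.2 (by linarith)
    have hbig : 2 * (r : ℝ) ^ 6 * (3 * (r : ℝ) ^ 2) ≤ Real.exp (L / 2) := by
      have h1 : L / 2 ≤ Real.exp (L / 2) := by linarith [Real.add_one_le_exp (L / 2)]
      have h2 : (2 : ℝ) ^ 3 * (r : ℝ) ^ 8 ≤ (r : ℝ) ^ 27 :=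
        (hpow2 3 8).trans (pow_le_pow_right₀ hR1 (by norm_num))
      nlinarith [pow_pos hR0 8]
    have : (P : ℝ) * 2 ^ P * (2 * (r : ℝ) ^ 6) ≤ N := by
      refine le_trans ?_ hN
      rw [le_div_iff₀ (by positivity), hexp]
      calc (P : ℝ) * 2 ^ P * (2 * (r : ℝ) ^ 6) * (3 * (r : ℝ) ^ 2)
          = (P : ℝ) * 2 ^ P * (2 * (r : ℝ) ^ 6 * (3 * (r : ℝ) ^ 2)) := by ring
        _ ≤ Real.exp (L / 2) * Real.exp (L / 2) :=
            mul_le_mul h4P hbig (by positivity) (by positivity)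
        _ = Real.exp L := by rw [← Real.exp_add]; ring_nf
    exact_mod_cast this
  -- Split `n = n ^ (1 - d) * n ^ (d / 2) * n ^ (d / 2)`: one factor `n ^ (d / 2)` pays for the
  -- power of two, the other for `12 r⁸`, which includes a `2` from rounding up.
  · set d := √c with hd
    have hdd : d * d = c := Real.mul_self_sqrt hc0.le
    have hd0 : 0 < d := Real.sqrt_pos.2 hc0
    have hd13 : d * (r : ℝ) ^ 13 ≤ 1 := by
      refine abs_le_one_iff_mul_self_le_one.2 ?_ |> (le_abs_self _).trans
      have : d * (r : ℝ) ^ 13 * (d * (r : ℝ) ^ 13) = c * (r : ℝ) ^ 26 := by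
        rw [← hdd]; ring
      rw [this]
      exact hpow 26 (by nlinarith)
    have hd1 : d ≤ 1 := by
      have : (1 : ℝ) ≤ (r : ℝ) ^ 13 := one_le_pow₀ hR1
      nlinarith
    have ht : (⌈(n : ℝ) ^ (1 - d)⌉₊ : ℝ) ≤ 2 * Real.exp (L * (1 - d)) := by
      have h1 : (n : ℝ) ^ (1 - d) = Real.exp (L * (1 - d)) := Real.rpow_def_of_pos hnpos _
      have h2 : 1 ≤ Real.exp (L * (1 - d)) :=
        Real.one_le_exp (mul_nonneg hL.le (by linarith))
      rw [h1]
      linarith [Nat.ceil_lt_add_one (by positivity : 0 ≤ Real.exp (L * (1 - d)))]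
    have h2s : (2 : ℝ) ^ (s * (2 * r ^ 6)) ≤ Real.exp (d * L / 2) := by
      calc (2 : ℝ) ^ (s * (2 * r ^ 6)) ≤ Real.exp 1 ^ (s * (2 * r ^ 6)) := by
            gcongr
            linarith [Real.add_one_le_exp (1 : ℝ)]
        _ = Real.exp (s * (2 * (r : ℝ) ^ 6)) := by rw [Real.exp_one_pow]; push_cast; rfl
        _ ≤ _ := by
            refine Real.exp_le_exp.2 ?_
            have h1 : d * (2 * (r : ℝ) ^ 6) ≤ 1 / 2 := by
              have := (hpow2 2 6).trans (pow_le_pow_right₀ hR1 (by norm_num : 2 + 6 ≤ 13))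
              nlinarith
            calc (s : ℝ) * (2 * (r : ℝ) ^ 6) ≤ c * L * (2 * (r : ℝ) ^ 6) := by gcongr
              _ = d * L * (d * (2 * (r : ℝ) ^ 6)) := by rw [← hdd]; ring
              _ ≤ d * L * (1 / 2) := mul_le_mul_of_nonneg_left h1 (by positivity)
              _ = d * L / 2 := by ring
    have hbig : 12 * (r : ℝ) ^ 8 ≤ Real.exp (d * L / 2) := by
      have h1 : d * L / 2 ≤ Real.exp (d * L / 2) := by linarith [Real.add_one_le_exp (d * L / 2)]
      have h2 : (2 : ℝ) ^ 4 * (r : ℝ) ^ 8 ≤ (r : ℝ) ^ 13 :=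
        (hpow2 4 8).trans (pow_le_pow_right₀ hR1 (by norm_num))
      have h3 : 2 * (r : ℝ) ^ 13 ≤ d * L := by
        calc 2 * (r : ℝ) ^ 13 ≤ c * L * (r : ℝ) ^ 13 := by gcongr
          _ = d * L * (d * (r : ℝ) ^ 13) := by rw [← hdd]; ring
          _ ≤ d * L * 1 := mul_le_mul_of_nonneg_left hd13 (by positivity)
          _ = d * L := mul_one _
      nlinarith [pow_pos hR0 8]
    have : (⌈(n : ℝ) ^ (1 - d)⌉₊ : ℝ) * 2 ^ (s * (2 * r ^ 6)) * (2 * (r : ℝ) ^ 6) ≤ N := by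
      refine le_trans ?_ hN
      rw [le_div_iff₀ (by positivity), hexp]
      calc (⌈Real.exp L ^ (1 - d)⌉₊ : ℝ) * 2 ^ (s * (2 * r ^ 6)) * (2 * (r : ℝ) ^ 6) *
            (3 * (r : ℝ) ^ 2)
          ≤ 2 * Real.exp (L * (1 - d)) * Real.exp (d * L / 2) * (2 * (r : ℝ) ^ 6) *
            (3 * (r : ℝ) ^ 2) := by
            rw [← hexp]
            gcongr
        _ = Real.exp (L * (1 - d)) * Real.exp (d * L / 2) * (12 * (r : ℝ) ^ 8) := by ring
        _ ≤ Real.exp (L * (1 - d)) * Real.exp (d * L / 2) * Real.exp (d * L / 2) := by gcongr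
        _ = Real.exp L := by rw [← Real.exp_add, ← Real.exp_add]; ring_nf
    exact_mod_cast this

/-! ### Turán numbers and the dense induced subgraph -/

open Finset in
-- The loss `r²` comes from the remainder `n % r`, the loss `2` from the floor in the formula for
-- the Turán number.
theorem le_two_mul_card_edgeFinset_turanGraph {n r : ℕ} (hr : 1 ≤ r) :
    (1 - 1 / (r : ℝ)) * (n : ℝ) ^ 2 - (r : ℝ) ^ 2 - 2 ≤
      2 * #(SimpleGraph.turanGraph n r).edgeFinset := by
  have hR : (1 : ℝ) ≤ r := by exact_mod_cast hr
  have hm : n % r < r := Nat.mod_lt _ hr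
  have hmR : ((n % r : ℕ) : ℝ) ≤ r := by exact_mod_cast hm.le
  have hle : (n % r) ^ 2 ≤ n ^ 2 := Nat.pow_le_pow_left (Nat.mod_le _ _) 2
  have hdiv := Nat.lt_div_mul_add (a := (n ^ 2 - (n % r) ^ 2) * (r - 1)) (b := 2 * r) (by omega)
  have hge : (n ^ 2 - (n % r) ^ 2) * (r - 1) / (2 * r) ≤
      #(SimpleGraph.turanGraph n r).edgeFinset := by
    rw [SimpleGraph.card_edgeFinset_turanGraph]
    exact Nat.le_add_right _ _
  have h1 : (n ^ 2 - (n % r) ^ 2) * (r - 1) ≤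
      #(SimpleGraph.turanGraph n r).edgeFinset * (2 * r) + 2 * r :=
    hdiv.le.trans (by gcongr)
  have h2 : ((n : ℝ) ^ 2 - ((n % r : ℕ) : ℝ) ^ 2) * (r - 1) ≤
      #(SimpleGraph.turanGraph n r).edgeFinset * (2 * r) + 2 * r := by
    have : (((n ^ 2 - (n % r) ^ 2) * (r - 1) : ℕ) : ℝ) ≤
        ((#(SimpleGraph.turanGraph n r).edgeFinset * (2 * r) + 2 * r : ℕ) : ℝ) := by
      exact_mod_cast h1
    rw [Nat.cast_mul, Nat.cast_sub hle, Nat.cast_sub hr] at this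
    simpa using this
  have h3 : ((n % r : ℕ) : ℝ) ^ 2 ≤ (r : ℝ) ^ 2 := by gcongr
  refine le_of_mul_le_mul_right ?_ (by linarith : (0 : ℝ) < r)
  have e : ((1 - 1 / (r : ℝ)) * (n : ℝ) ^ 2 - (r : ℝ) ^ 2 - 2) * r =
      (n : ℝ) ^ 2 * (r - 1) - (r : ℝ) ^ 3 - 2 * r := by
    field_simp
  rw [e]
  nlinarith [sq_nonneg (r : ℝ)]

theorem two_mul_card_edgeFinset_turanGraph_le {n r : ℕ} (hr : 1 ≤ r) :
    2 * ((SimpleGraph.turanGraph n r).edgeFinset.card : ℝ) ≤ (1 - 1 / (r : ℝ)) * (n : ℝ) ^ 2 := by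
  have hR : (1 : ℝ) ≤ r := by exact_mod_cast hr
  have h := SimpleGraph.mul_card_edgeFinset_turanGraph_le (n := n) (r := r)
  have h' : ((2 * r * (SimpleGraph.turanGraph n r).edgeFinset.card : ℕ) : ℝ) ≤
      (((r - 1) * n ^ 2 : ℕ) : ℝ) := by exact_mod_cast h
  rw [Nat.cast_mul (r - 1), Nat.cast_sub hr] at h'
  push_cast at h'
  refine le_of_mul_le_mul_right ?_ (by linarith : (0 : ℝ) < r)
  rw [show (1 - 1 / (r : ℝ)) * (n : ℝ) ^ 2 * r = (r - 1) * (n : ℝ) ^ 2 by field_simp]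
  linarith

open Finset in
theorem degree_induce_eq_card_filter {V : Type*} [Fintype V] [DecidableEq V] (G : SimpleGraph V)
    [DecidableRel G.Adj] (U : Finset V) (v : (U : Set V)) :
    (G.induce (U : Set V)).degree v = #{y ∈ U | G.Adj v y} := by
  rw [SimpleGraph.degree, SimpleGraph.neighborFinset_eq_filter]
  refine card_bij (fun a _ => (a : V)) ?_ ?_ ?_
  · intro a ha
    exact mem_filter.2 ⟨a.2, by simpa using ha⟩
  · intro a _ b _ hab
    exact Subtype.ext hab
  · intro b hb
    rw [mem_filter] at hb
    exact ⟨⟨b, hb.1⟩, by simpa using hb.2, rfl⟩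

open Finset in
theorem two_mul_card_edgeFinset_induce {V : Type*} [Fintype V] [DecidableEq V] (G : SimpleGraph V)
    [DecidableRel G.Adj] (U : Finset V) :
    2 * (#(G.induce (U : Set V)).edgeFinset : ℝ) = ∑ x ∈ U, (#{y ∈ U | G.Adj x y} : ℝ) := by
  have h := (G.induce (U : Set V)).sum_degrees_eq_twice_card_edges
  simp only [degree_induce_eq_card_filter] at h
  rw [← Finset.sum_coe_sort U (fun x => (#{y ∈ U | G.Adj x y} : ℝ))]
  exact_mod_cast h.symm

open Finset in
/-- A large graph with more than `t_r(n)` edges contains a large induced subgraph with a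
`(r + 1)`-clique and minimum degree close to `(1 - 1 / r)` times its order. -/
theorem exists_induce_degree_ge {V : Type*} [Fintype V] [DecidableEq V] (G : SimpleGraph V)
    [DecidableRel G.Adj] {r : ℕ} (hr : 2 ≤ r) (hn : 36 * (r : ℝ) ^ 6 ≤ Fintype.card V)
    (hG : #(SimpleGraph.turanGraph (Fintype.card V) r).edgeFinset < #G.edgeFinset) :
    ∃ U : Finset V, (Fintype.card V : ℝ) / (3 * (r : ℝ) ^ 2) ≤ #U ∧
      ¬ (G.induce (U : Set V)).CliqueFree (r + 1) ∧
      ∀ v : (U : Set V), (1 - 1 / (r : ℝ) - 1 / (3 * (r : ℝ) ^ 4)) * #U ≤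
        (G.induce (U : Set V)).degree v := by
  have hR : (2 : ℝ) ≤ r := by exact_mod_cast hr
  have hlow := le_two_mul_card_edgeFinset_turanGraph (n := Fintype.card V) (r := r) (by omega)
  set n : ℝ := (Fintype.card V : ℝ) with hndef
  set R : ℝ := (r : ℝ) with hRdef
  have hR0 : 0 < R := by linarith
  -- The gap between `1 / (4 r⁴)` and the required `1 / (3 r⁴)` absorbs the `-1` in the degree bound
  -- once `#U ≥ 12 r⁴`.
  set lam : ℝ := 1 - 1 / R - 1 / (4 * R ^ 4) with hlam
  have hinv : 1 / R ≤ 1 / 2 := one_div_le_one_div_of_le (by norm_num) hR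
  have h4 : (16 : ℝ) ≤ R ^ 4 := by nlinarith [pow_le_pow_left₀ (by norm_num : (0 : ℝ) ≤ 2) hR 4]
  have hinv4 : 1 / (4 * R ^ 4) ≤ 1 / 2 :=
    one_div_le_one_div_of_le (by norm_num) (by linarith)
  have hinv0 : 0 < 1 / R := by positivity
  have hinv40 : 0 < 1 / (4 * R ^ 4) := by positivity
  let f : Finset V → ℝ := fun S => ∑ x ∈ S, (#{y ∈ S | G.Adj x y} : ℝ)
  obtain ⟨U, -, hU⟩ := exists_max_image (univ : Finset (Finset V))
    (fun S => f S - lam * (#S : ℝ) ^ 2) ⟨∅, mem_univ _⟩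
  replace hU := fun S => hU S (mem_univ S)
  have hfuniv : f univ = 2 * (#G.edgeFinset : ℝ) := by
    have := G.sum_degrees_eq_twice_card_edges
    simp only [SimpleGraph.degree, SimpleGraph.neighborFinset_eq_filter] at this
    simp only [f]
    exact_mod_cast this
  have hG' : (#(SimpleGraph.turanGraph (Fintype.card V) r).edgeFinset : ℝ) + 1 ≤
      #G.edgeFinset := by exact_mod_cast hG
  have hfU : n ^ 2 / (4 * R ^ 4) - R ^ 2 ≤ f U - lam * (#U : ℝ) ^ 2 := by
    refine le_trans ?_ (hU univ)
    rw [card_univ, hfuniv, ← hndef, hlam]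
    have : n ^ 2 / (4 * R ^ 4) = 1 / (4 * R ^ 4) * n ^ 2 := by ring
    rw [this]
    nlinarith
  have hUn : (#U : ℝ) ≤ n := by
    rw [hndef]
    exact_mod_cast card_le_univ U
  have hfle : f U ≤ (#U : ℝ) ^ 2 := by
    have : f U ≤ ∑ x ∈ U, (#U : ℝ) :=
      sum_le_sum fun x _ => by exact_mod_cast card_le_card (filter_subset _ _)
    rw [sum_const, nsmul_eq_mul] at this
    linarith [sq (#U : ℝ)]
  have hn2 : (36 * R ^ 6) ^ 2 ≤ n ^ 2 := by gcongr
  have hR6 : (64 : ℝ) ≤ R ^ 6 := by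
    nlinarith [pow_le_pow_left₀ (by norm_num : (0 : ℝ) ≤ 2) hR 6]
  have hn0 : 0 < n := by linarith
  have hbig : n / (3 * R ^ 2) ≤ #U := by
    refine (sq_le_sq₀ (by positivity) (by positivity)).1 ?_
    have hlam0 : 0 ≤ lam * (#U : ℝ) ^ 2 := mul_nonneg (by linarith) (by positivity)
    have e : n ^ 2 / (4 * R ^ 4) - R ^ 2 - (n / (3 * R ^ 2)) ^ 2 =
        (5 * n ^ 2 - 36 * R ^ 6) / (36 * R ^ 4) := by
      field_simp
      ring
    have h0 : 0 ≤ n ^ 2 / (4 * R ^ 4) - R ^ 2 - (n / (3 * R ^ 2)) ^ 2 := by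
      rw [e]
      exact div_nonneg (by nlinarith) (by positivity)
    linarith
  refine ⟨U, hbig, ?_, ?_⟩
  · intro hfree
    have hT := hfree.card_edgeFinset_le
    have h2 := two_mul_card_edgeFinset_induce G U
    simp only [← SimpleGraph.card_edgeFinset_turanGraph] at hT
    have hcU : Fintype.card (U : Set V) = #U := by simp
    rw [hcU] at hT
    have hT' : (#(G.induce (U : Set V)).edgeFinset : ℝ) ≤
      #(SimpleGraph.turanGraph (#U) r).edgeFinset := by exact_mod_cast hT
    change _ = f U at h2
    by_cases hUu : U = univ
    · rw [hUu] at h2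
      have h3 : (#(SimpleGraph.turanGraph (#U) r).edgeFinset : ℝ) =
        #(SimpleGraph.turanGraph (Fintype.card V) r).edgeFinset := by
        rw [hUu, card_univ]
      rw [← hUu] at h2 hfuniv
      linarith
    -- If `U` is proper and clique-free, its objective is at most `#U² / (4 r⁴)`; with `#U ≤ n - 1`
    -- this falls below the value at the whole vertex set.
    · have hlt : (#U : ℝ) + 1 ≤ n := by
        have : #U < Fintype.card V := by
          rw [← card_univ]
          exact card_lt_card (ssubset_univ_iff.2 hUu)
        rw [hndef]
        exact_mod_cast this
      have h3 := two_mul_card_edgeFinset_turanGraph_le (n := #U) (r := r) (by omega)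
      have h5 : n ^ 2 / (4 * R ^ 4) - R ^ 2 ≤ (#U : ℝ) ^ 2 / (4 * R ^ 4) := by
        have : (#U : ℝ) ^ 2 / (4 * R ^ 4) = (1 - 1 / R) * (#U : ℝ) ^ 2 - lam * (#U : ℝ) ^ 2 := by
          rw [hlam]; ring
        rw [this]
        linarith
      have h6 : n ^ 2 - 4 * R ^ 6 ≤ (#U : ℝ) ^ 2 := by
        rw [div_sub' (by positivity), div_le_div_iff_of_pos_right (by positivity)] at h5
        linarith
      have h0 : (0 : ℝ) ≤ #U := Nat.cast_nonneg _
      nlinarith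
  · intro v
    have h := le_card_adj_of_maximal G (by linarith : lam ≤ 2) hU v.2
    rw [degree_induce_eq_card_filter]
    refine le_trans ?_ h
    have h7 : 12 * R ^ 4 ≤ #U := by
      refine le_trans ?_ hbig
      rw [le_div_iff₀ (by positivity)]
      linarith
    have e : lam * (#U : ℝ) - 1 - (1 - 1 / R - 1 / (3 * R ^ 4)) * #U =
        (#U - 12 * R ^ 4) / (12 * R ^ 4) := by
      rw [hlam]
      field_simp
      ring
    rw [← sub_nonneg, e]
    exact div_nonneg (by linarith) (by positivity)

/-! ### The main theorem -/

theorem theorem1 (r n : ℕ) (hr : 2 ≤ r) (c : ℝ)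
    (hc_lower : 2 / Real.log (n : ℝ) ≤ c)
    (hc_upper : c ≤ ((r : ℝ) ^ ((r + 7) * (r + 1)))⁻¹)
    {V : Type*} [Fintype V] (G : SimpleGraph V) [Fintype G.edgeSet]
    (hV : Fintype.card V = n)
    (hG : G.edgeFinset.card = (SimpleGraph.turanGraph n r).edgeFinset.card + 1) :
    SimpleGraph.IsContained
      (multipartitePlus
        (partSizes r ⌊c * Real.log (n : ℝ)⌋₊ ⌈(n : ℝ) ^ (1 - Real.sqrt c)⌉₊)) G := by
  classical
  -- The edge count alone forces an edge, which makes `log n` positive.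
  have hn : 2 ≤ n := by
    obtain ⟨e, he⟩ := Finset.card_pos.1 (by omega : 0 < G.edgeFinset.card)
    induction e with
    | h u v =>
      have huv : G.Adj u v := by simpa using he
      rw [← hV]
      have : Nontrivial V := ⟨u, v, huv.ne⟩
      exact Fintype.one_lt_card
  have hL : 0 < Real.log n := Real.log_pos (by exact_mod_cast hn)
  have hR : (2 : ℝ) ≤ r := by exact_mod_cast hr
  have hbig : 36 * (r : ℝ) ^ 6 ≤ Fintype.card V := by
    have h1 : c * (r : ℝ) ^ ((r + 7) * (r + 1)) ≤ 1 := by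
      rwa [← one_div, le_div_iff₀ (by positivity)] at hc_upper
    have hc0 : 0 < c := lt_of_lt_of_le (by positivity) hc_lower
    have h2 : c * (r : ℝ) ^ 12 ≤ 1 :=
      (mul_le_mul_of_nonneg_left (pow_le_pow_right₀ (by linarith) (by nlinarith)) hc0.le).trans h1
    have h3 : 2 ≤ c * Real.log n := by rwa [div_le_iff₀ hL] at hc_lower
    have h4 : 2 * (r : ℝ) ^ 12 ≤ Real.log n := by
      have := mul_le_mul_of_nonneg_right h2 hL.le
      nlinarith [pow_pos (by linarith : (0 : ℝ) < r) 12]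
    have h5 : Real.log n ≤ n := (Real.log_le_sub_one_of_pos (by positivity)).trans (by linarith)
    have h6 : (64 : ℝ) ≤ (r : ℝ) ^ 6 := by
      nlinarith [pow_le_pow_left₀ (by norm_num : (0 : ℝ) ≤ 2) hR 6]
    rw [hV]
    nlinarith
  obtain ⟨U, hU, hclique, hdeg⟩ := exists_induce_degree_ge G hr hbig (by
    rw [hV]
    have : G.edgeFinset.card = (SimpleGraph.turanGraph n r).edgeFinset.card + 1 := by
      convert hG
    convert Nat.lt_of_succ_le this.ge)
  rw [hV] at hU
  obtain ⟨hs, hN, ht⟩ := part_size_bounds hr hL hc_lower hc_upper hU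
  have hcU : Fintype.card (U : Set V) = U.card := by simp
  rw [← hcU] at hN ht hdeg
  exact (multipartitePlus_isContained_of_degree hr hs hclique hdeg hN ht).trans
    ⟨SimpleGraph.Copy.induce G _⟩
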